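/- Let $d\ge 3$, let $\chi\in C^\infty(\mathbb{S}^{d-1})$ be real-valued with $\int_{\mathbb{S}^{d-1}}\chi=1$ (with respect to surface measure), and suppose that the closed cone $C_\chi:=\overline{\{x\in\mathbb{R}^d:\ x/|x|\in\operatorname{supp}\chi\}}$ is convex. Then there is a matrix $K_\chi=(K_\chi^{ij})_{1\le i,j\le d}$ of distributions in $\mathcal{D}'(\mathbb{R}^d)$, and for every $w\in\mathbb{S}^{d-1}$ a matrix $L_{\chi,w}=(L_{\chi,w}^{ij})_{1\le i,j\le d}$ of distributions in $\mathcal{D}'(\mathbb{R}^d)$, such that $$\sum_{i,j}\partial_i\partial_jK_\chi^{ij}=\delta,\qquad \sum_i\partial_iL_{\chi,w}^{ij}=w^j\,\delta\quad(1\le j\le d),$$ where $\delta$ is the Dirac distribution at the origin. Moreover: * $K_\chi$ and $L_{\chi,w}$ are symmetric: $K_\chi^{ij}=K_\chi^{ji}$ and $L_{\chi,w}^{ij}=L_{\chi,w}^{ji}$ for all $i,j$; * every component of $K_\chi$ and of $L_{\chi,w}$ is supported in $C_\chi$; * every $K_\chi^{ij}$ is homogeneous of degree $2-d$ and every $L_{\chi,w}^{ij}$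 is homogeneous of degree $1-d$ (a distribution $T$ is homogeneous of degree $a$ if $\langle T,\varphi(t\,\cdot)\rangle=t^{-a-d}\langle T,\varphi\rangle$ for all $t>0$ and all test functions $\varphi$); * every component of $K_\chi$ and of $L_{\chi,w}$ is given by a $C^\infty$ function on $\mathbb{R}^d\setminus\{0\}$. -/

import Mathlib

open MeasureTheory Metric
open scoped Distributions LineDeriv ContDiff Manifold

/-- Euclidean space `ℝ^d`. -/
abbrev Eucl (d : ℕ) : Type := EuclideanSpace ℝ (Fin d)

/-- The space `𝓓(ℝ^d)` of real-valued smooth compactly supported test functions. -/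
abbrev Test (d : ℕ) : Type := 𝓓((⊤ : TopologicalSpace.Opens (Eucl d)), ℝ)

/-- The space `𝓓'(ℝ^d)` of (real-valued) distributions. -/
abbrev Distr (d : ℕ) : Type := 𝓓'((⊤ : TopologicalSpace.Opens (Eucl d)), ℝ)

/-- The partial derivative `∂_i T` of a distribution on `ℝ^d`. -/
noncomputable def partialD {d : ℕ} (i : Fin d) (T : Distr d) : Distr d :=
  ∂_{(EuclideanSpace.single i (1 : ℝ) : Eucl d)} T

/-- The dilated test function `x ↦ φ (t • x)`, for `t > 0`. -/
noncomputable def dilateTest {d : ℕ} (t : ℝ) (ht : 0 < t) (φ : Test d) : Test d where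
  toFun x := φ (t • x)
  contDiff' := φ.contDiff.comp (contDiff_const_smul t)
  hasCompactSupport' := φ.hasCompactSupport.comp_homeomorph (Homeomorph.smulOfNeZero t ht.ne')
  tsupport_subset' := Set.subset_univ _

/-- A distribution `T` on `ℝ^d` is homogeneous of degree `a` if
`⟨T, φ(t ·)⟩ = t ^ (-(a + d)) ⟨T, φ⟩` for all `t > 0` and all test functions `φ`; for a locally
integrable function this says `T (t x) = t ^ a T x`. -/
def IsHomogeneousDistr {d : ℕ} (T : Distr d) (a : ℝ) : Prop :=
  ∀ (t : ℝ) (ht : 0 < t) (φ : Test d), T (dilateTest t ht φ) = t ^ (-(a + d)) * T φ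

/-- A distribution `T` on `ℝ^d` is smooth on the open set `U` if on `U` it is given by integration
against a `C^∞` function on `U`. -/
def IsSmoothOn {d : ℕ} (T : Distr d) (U : Set (Eucl d)) : Prop :=
  ∃ f : Eucl d → ℝ, ContDiffOn ℝ ∞ f U ∧
    ∀ φ : Test d, tsupport φ ⊆ U → T φ = ∫ x, f x * φ x

/-- The closure of the cone `{x ∈ ℝ^d : x / |x| ∈ supp χ}` over the support of a function on the
unit sphere. -/
def coneOf {d : ℕ} (χ : sphere (0 : Eucl d) 1 → ℝ) : Set (Eucl d) :=
  closure {x : Eucl d | ‖x‖⁻¹ • x ∈ (Subtype.val '' tsupport χ : Set (Eucl d))}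

/-! Take $K^{ij}(x)=|x|^{-d}\chi(x/|x|)\,x_ix_j$ (`coneKernel`). Paired with second derivatives of
$\varphi$, the sum over $i,j$ is $|x|^{-d}\chi(x/|x|)\,D^2\varphi(x)(x,x)$, which involves only the
second radial derivative. In polar coordinates the weights combine to $r$, and along each ray $y$
one has $\int_0^\infty r\,\partial_r^2[\varphi(ry)]\,dr=\varphi(0)$. What remains is
$\varphi(0)\int\chi=\varphi(0)$; see `sum_partialD_partialD_coneKernel`.

With $f_j=\sum_k\partial_kK^{kj}$, the matrix $w^jf_i$ already has divergence $w^j\delta$ but is not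
symmetric. Adding $w^if_j$ symmetrizes it at the cost of an extra $\partial_wf_j$, which subtracting
the symmetric matrix $\partial_wK^{ij}$ removes; see `sum_partialD_symmDivSolution`.

Support, homogeneity and smoothness are read off from $K$ and pass to $L$ through derivatives and
linear combinations. -/

/-! ### Derivatives, homogeneity, support and smoothness of distributions. -/

theorem TestFunction.lineDerivOp_apply_eq_fderiv {d : ℕ} (φ : Test d) (v x : Eucl d) :
    (∂_{v} φ : Test d) x = fderiv ℝ φ x v := by
  rw [TestFunction.lineDerivOp_eq_lineDerivCLM ℝ, TestFunction.lineDerivCLM_apply_of_le (by simp)]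
  exact ((φ.contDiff.differentiable (by simp)) x).lineDeriv_eq_fderiv

theorem TestFunction.tsupport_lineDerivOp_subset {d : ℕ} (φ : Test d) (v : Eucl d) :
    tsupport (∂_{v} φ : Test d) ⊆ tsupport φ := by
  have : (∂_{v} φ : Test d) = fun x => fderiv ℝ φ x v :=
    funext (φ.lineDerivOp_apply_eq_fderiv v)
  rw [this]
  exact tsupport_fderiv_apply_subset ℝ v

theorem TestFunction.lineDerivOp_lineDerivOp_apply {d : ℕ} (φ : Test d) (v w x : Eucl d) :
    (∂_{v} (∂_{w} φ : Test d) : Test d) x = fderiv ℝ (fderiv ℝ φ) x v w := by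
  have : (∂_{w} φ : Test d) = fun x => fderiv ℝ φ x w :=
    funext (φ.lineDerivOp_apply_eq_fderiv w)
  rw [TestFunction.lineDerivOp_apply_eq_fderiv, this]
  have hφ : DifferentiableAt ℝ (fderiv ℝ φ) x :=
    ((φ.contDiff.fderiv_right (m := 1) (by decide)).differentiable one_ne_zero) x
  rw [fderiv_clm_apply hφ (differentiableAt_const w)]
  simp

theorem TestFunction.lineDerivOp_comm {d : ℕ} (φ : Test d) (v w : Eucl d) :
    (∂_{v} (∂_{w} φ : Test d) : Test d) = ∂_{w} (∂_{v} φ : Test d) := by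
  ext x
  rw [φ.lineDerivOp_lineDerivOp_apply, φ.lineDerivOp_lineDerivOp_apply]
  exact (φ.contDiff.contDiffAt.isSymmSndFDerivAt (by
    rw [minSmoothness_of_isRCLikeNormedField]; decide)) v w

theorem Distribution.lineDerivOp_comm {d : ℕ} (T : Distr d) (v w : Eucl d) :
    (∂_{v} (∂_{w} T : Distr d) : Distr d) = ∂_{w} (∂_{v} T : Distr d) := by
  ext φ
  simp only [Distribution.lineDerivOp_apply_apply, LineDeriv.lineDerivOp_neg, neg_neg]
  rw [φ.lineDerivOp_comm]

theorem lineDerivOp_dilateTest {d : ℕ} (t : ℝ) (ht : 0 < t) (φ : Test d) (v : Eucl d) :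
    (∂_{v} (dilateTest t ht φ) : Test d) = t • dilateTest t ht (∂_{v} φ) := by
  ext x
  rw [TestFunction.lineDerivOp_apply_eq_fderiv]
  change fderiv ℝ (fun x => φ (t • x)) x v = t * (∂_{v} φ : Test d) (t • x)
  rw [TestFunction.lineDerivOp_apply_eq_fderiv, fderiv_comp_smul]
  simp

theorem IsHomogeneousDistr.lineDerivOp {d : ℕ} {T : Distr d} {a : ℝ}
    (hT : IsHomogeneousDistr T a) (v : Eucl d) :
    IsHomogeneousDistr (∂_{v} T : Distr d) (a - 1) := by
  intro t ht φ
  simp only [Distribution.lineDerivOp_apply_apply, map_neg]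
  rw [lineDerivOp_dilateTest, map_smul, hT t ht,
    show -(a - 1 + d) = -(a + d) + 1 by ring, Real.rpow_add_one ht.ne']
  simp only [smul_eq_mul]
  ring

theorem IsHomogeneousDistr.add {d : ℕ} {S T : Distr d} {a : ℝ}
    (hS : IsHomogeneousDistr S a) (hT : IsHomogeneousDistr T a) :
    IsHomogeneousDistr (S + T) a := by
  intro t ht φ
  change S _ + T _ = _ * (S _ + T _)
  rw [hS t ht, hT t ht, mul_add]

theorem IsHomogeneousDistr.smul {d : ℕ} {T : Distr d} {a : ℝ}
    (hT : IsHomogeneousDistr T a) (c : ℝ) : IsHomogeneousDistr (c • T) a := by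
  intro t ht φ
  change c * T _ = _ * (c * T _)
  rw [hT t ht, mul_left_comm]

theorem IsHomogeneousDistr.zero {d : ℕ} {a : ℝ} : IsHomogeneousDistr (0 : Distr d) a := by
  intro t ht φ
  change (0 : ℝ) = _ * (0 : ℝ)
  rw [mul_zero]

theorem Distribution.IsVanishingOn.distr_add {d : ℕ} {S T : Distr d} {U : Set (Eucl d)}
    (hS : IsVanishingOn S U) (hT : IsVanishingOn T U) : IsVanishingOn (S + T) U := by
  intro φ hφ
  change S φ + T φ = 0
  rw [hS φ hφ, hT φ hφ, add_zero]

theorem Distribution.IsVanishingOn.distr_smul {d : ℕ} {T : Distr d} {U : Set (Eucl d)}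
    (hT : IsVanishingOn T U) (c : ℝ) : IsVanishingOn (c • T) U := by
  intro φ hφ
  change c * T φ = 0
  rw [hT φ hφ, mul_zero]

theorem Distribution.dsupport_subset_of_isVanishingOn_compl {d : ℕ} {T : Distr d}
    {C : Set (Eucl d)} (hC : IsClosed C) (hT : IsVanishingOn T Cᶜ) : dsupport T ⊆ C :=
  Set.sInter_subset_of_mem ⟨hT, hC⟩

/-- Nothing is assumed of `f` off `U`: the product vanishes near every point outside `tsupport g`.
-/
theorem contDiff_mul_of_tsupport_subset {d : ℕ} {U : Set (Eucl d)} (hU : IsOpen U)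
    {f g : Eucl d → ℝ} {n : ℕ∞ω} (hf : ContDiffOn ℝ n f U) (hg : ContDiff ℝ n g)
    (hgU : tsupport g ⊆ U) : ContDiff ℝ n (fun x => f x * g x) :=
  (contMDiff_of_tsupport (I := 𝓘(ℝ, Eucl d)) (I' := 𝓘(ℝ, ℝ)) fun _ hx =>
    ((hf.contDiffAt (hU.mem_nhds (hgU (tsupport_mul_subset_right hx)))).mul
      hg.contDiffAt).contMDiffAt).contDiff

theorem integrable_mul_of_tsupport_subset {d : ℕ} {U : Set (Eucl d)} (hU : IsOpen U)
    {f : Eucl d → ℝ} (hf : ContDiffOn ℝ ∞ f U) (φ : Test d) (hφ : tsupport φ ⊆ U) :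
    Integrable (fun x => f x * φ x) :=
  (contDiff_mul_of_tsupport_subset hU hf φ.contDiff hφ).continuous.integrable_of_hasCompactSupport
    φ.hasCompactSupport.mul_left

theorem IsSmoothOn.add {d : ℕ} {S T : Distr d} {U : Set (Eucl d)} (hU : IsOpen U)
    (hS : IsSmoothOn S U) (hT : IsSmoothOn T U) : IsSmoothOn (S + T) U := by
  obtain ⟨f, hf, hSf⟩ := hS
  obtain ⟨g, hg, hTg⟩ := hT
  refine ⟨fun x => f x + g x, hf.add hg, fun φ hφ => ?_⟩
  change S φ + T φ = _
  rw [hSf φ hφ, hTg φ hφ, ← integral_add (integrable_mul_of_tsupport_subset hU hf φ hφ)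
    (integrable_mul_of_tsupport_subset hU hg φ hφ)]
  simp only [add_mul]

theorem IsSmoothOn.smul {d : ℕ} {T : Distr d} {U : Set (Eucl d)}
    (hT : IsSmoothOn T U) (c : ℝ) : IsSmoothOn (c • T) U := by
  obtain ⟨f, hf, hTf⟩ := hT
  refine ⟨fun x => c * f x, contDiffOn_const.mul hf, fun φ hφ => ?_⟩
  change c * T φ = _
  rw [hTf φ hφ, ← integral_const_mul]
  simp only [mul_assoc]

theorem IsSmoothOn.zero {d : ℕ} {U : Set (Eucl d)} : IsSmoothOn (0 : Distr d) U :=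
  ⟨0, contDiffOn_const, fun φ _ => by simp⟩

/-- The density is the classical derivative of `f`. Integration by parts needs `f` differentiable
only on `tsupport φ`, which lies in `U`. -/
theorem IsSmoothOn.lineDerivOp {d : ℕ} {T : Distr d} {U : Set (Eucl d)} (hU : IsOpen U)
    (hT : IsSmoothOn T U) (v : Eucl d) : IsSmoothOn (∂_{v} T : Distr d) U := by
  obtain ⟨f, hf, hTf⟩ := hT
  have hf' : ContDiffOn ℝ ∞ (fun x => fderiv ℝ f x v) U :=
    (hf.fderiv_of_isOpen hU (by simp)).clm_apply contDiffOn_const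
  refine ⟨fun x => fderiv ℝ f x v, hf', fun φ hφ => ?_⟩
  have hφ' := (φ.tsupport_lineDerivOp_subset v).trans hφ
  have key := integral_mul_fderiv_eq_neg_fderiv_mul_of_integrable (μ := volume) (f := f) (g := φ)
    (v := v) (integrable_mul_of_tsupport_subset hU hf' φ hφ)
    (by simpa only [TestFunction.lineDerivOp_apply_eq_fderiv] using
      integrable_mul_of_tsupport_subset hU hf (∂_{v} φ) hφ')
    (integrable_mul_of_tsupport_subset hU hf φ hφ)
    (fun x hx => (hf.contDiffAt (hU.mem_nhds (hφ hx))).differentiableAt (by simp))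
    (fun x _ => φ.contDiff.differentiable (by simp) x)
  rw [Distribution.lineDerivOp_apply_apply, map_neg, hTf _ hφ']
  simp only [TestFunction.lineDerivOp_apply_eq_fderiv]
  rw [key, neg_neg]

/-! ### The kernel on the cone. -/

open Classical in
/-- The extension of a function on the unit sphere to `ℝ^d` that is constant along open rays
from the origin and vanishes at the origin. -/
noncomputable def raywiseExtension {d : ℕ} (χ : sphere (0 : Eucl d) 1 → ℝ) (x : Eucl d) : ℝ :=
  if h : ‖x‖⁻¹ • x ∈ sphere (0 : Eucl d) 1 then χ ⟨‖x‖⁻¹ • x, h⟩ else 0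

theorem norm_inv_smul_mem_sphere {d : ℕ} {x : Eucl d} (hx : x ≠ 0) :
    ‖x‖⁻¹ • x ∈ sphere (0 : Eucl d) 1 := by
  simp [norm_smul, hx]

theorem raywiseExtension_of_ne_zero {d : ℕ} (χ : sphere (0 : Eucl d) 1 → ℝ) {x : Eucl d}
    (hx : x ≠ 0) :
    raywiseExtension χ x = χ ⟨‖x‖⁻¹ • x, norm_inv_smul_mem_sphere hx⟩ :=
  dif_pos _

open Classical in
theorem raywiseExtension_smul {d : ℕ} (χ : sphere (0 : Eucl d) 1 → ℝ) {t : ℝ} (ht : 0 < t)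
    (x : Eucl d) : raywiseExtension χ (t • x) = raywiseExtension χ x := by
  have : ‖t • x‖⁻¹ • t • x = ‖x‖⁻¹ • x := by
    rw [norm_smul, Real.norm_of_nonneg ht.le, smul_smul]
    congr 1
    field_simp
  unfold raywiseExtension
  exact congrArg (fun z => if h : z ∈ sphere (0 : Eucl d) 1 then χ ⟨z, h⟩ else 0) this

theorem raywiseExtension_coe {d : ℕ} (χ : sphere (0 : Eucl d) 1 → ℝ)
    (y : sphere (0 : Eucl d) 1) : raywiseExtension χ y = χ y := by
  rw [raywiseExtension_of_ne_zero χ (ne_zero_of_mem_unit_sphere y)]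
  congr 1
  ext1
  simp

theorem mem_coneOf_of_raywiseExtension_ne_zero {d : ℕ} {χ : sphere (0 : Eucl d) 1 → ℝ}
    {x : Eucl d} (hx : raywiseExtension χ x ≠ 0) : x ∈ coneOf χ := by
  unfold raywiseExtension at hx
  split_ifs at hx with h
  · exact subset_closure ⟨_, subset_tsupport χ hx, rfl⟩
  · exact absurd rfl hx

theorem contDiffOn_raywiseExtension {d n : ℕ} [Fact (Module.finrank ℝ (Eucl d) = n + 1)]
    {χ : sphere (0 : Eucl d) 1 → ℝ} (hχ : ContMDiff (𝓡 n) 𝓘(ℝ, ℝ) ∞ χ) :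
    ContDiffOn ℝ ∞ (raywiseExtension χ) {0}ᶜ := by
  let U : TopologicalSpace.Opens (Eucl d) := ⟨{0}ᶜ, isOpen_compl_singleton⟩
  have hval : ContMDiff 𝓘(ℝ, Eucl d) 𝓘(ℝ, Eucl d) ∞ fun x : U => ‖(x : Eucl d)‖⁻¹ • (x : Eucl d) :=
    fun x => contMDiffAt_subtype_iff.2
      (((contDiffAt_norm ℝ x.2).inv (norm_ne_zero_iff.2 x.2)).smul contDiffAt_id).contMDiffAt
  have h := hχ.comp (hval.codRestrict_sphere fun x => norm_inv_smul_mem_sphere x.2)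
  intro x hx
  refine ContDiffAt.contDiffWithinAt (contMDiffAt_iff_contDiffAt.1 ?_)
  refine (contMDiffAt_subtype_iff (U := U) (x := ⟨x, hx⟩) (f := raywiseExtension χ)).1 ?_
  convert! h ⟨x, hx⟩ using 1
  funext y
  exact raywiseExtension_of_ne_zero χ y.2

theorem exists_abs_raywiseExtension_le {d : ℕ} {χ : sphere (0 : Eucl d) 1 → ℝ}
    (hχ : Continuous χ) : ∃ C, 0 ≤ C ∧ ∀ x, |raywiseExtension χ x| ≤ C := by
  obtain ⟨C, hC⟩ := (isCompact_univ.image hχ).isBounded.exists_norm_le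
  refine ⟨max C 0, le_max_right _ _, fun x => ?_⟩
  unfold raywiseExtension
  split_ifs with h
  · exact (hC _ ⟨_, trivial, rfl⟩).trans (le_max_left _ _)
  · simp

/-- The function `x ↦ |x|^{-d} χ(x/|x|) x_i x_j`, homogeneous of degree `2 - d`. -/
noncomputable def coneKernel {d : ℕ} (χ : sphere (0 : Eucl d) 1 → ℝ) (i j : Fin d)
    (x : Eucl d) : ℝ :=
  (‖x‖ ^ d)⁻¹ * raywiseExtension χ x * (x i * x j)

theorem coneKernel_comm {d : ℕ} (χ : sphere (0 : Eucl d) 1 → ℝ) (i j : Fin d) :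
    coneKernel χ i j = coneKernel χ j i := by
  funext x
  simp only [coneKernel, mul_comm]

theorem coneKernel_smul {d : ℕ} (χ : sphere (0 : Eucl d) 1 → ℝ) (i j : Fin d) {t : ℝ}
    (ht : 0 < t) (x : Eucl d) :
    coneKernel χ i j (t • x) = (t ^ d)⁻¹ * t ^ 2 * coneKernel χ i j x := by
  simp only [coneKernel, raywiseExtension_smul χ ht, norm_smul, Real.norm_of_nonneg ht.le, mul_pow,
    mul_inv, PiLp.smul_apply, smul_eq_mul]
  ring

theorem contDiffOn_coneKernel {d n : ℕ} [Fact (Module.finrank ℝ (Eucl d) = n + 1)]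
    {χ : sphere (0 : Eucl d) 1 → ℝ} (hχ : ContMDiff (𝓡 n) 𝓘(ℝ, ℝ) ∞ χ) (i j : Fin d) :
    ContDiffOn ℝ ∞ (coneKernel χ i j) {0}ᶜ := by
  have hnorm : ContDiffOn ℝ ∞ (fun x : Eucl d => (‖x‖ ^ d)⁻¹) {0}ᶜ := fun x hx =>
    (((contDiffAt_norm ℝ hx).pow d).inv
      (pow_ne_zero d (norm_ne_zero_iff.2 hx))).contDiffWithinAt
  exact (hnorm.mul (contDiffOn_raywiseExtension hχ)).mul
    (ContDiff.contDiffOn (by fun_prop))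

/-- The kernel is bounded by $C|x|^{2-d}$, whose radial integrand $r^{d-1}\cdot Cr^{2-d}=Cr$ is
integrable near $0$. -/
theorem locallyIntegrable_coneKernel {d n : ℕ} [Fact (Module.finrank ℝ (Eucl d) = n + 1)]
    {χ : sphere (0 : Eucl d) 1 → ℝ} (hχ : ContMDiff (𝓡 n) 𝓘(ℝ, ℝ) ∞ χ) (i j : Fin d) :
    LocallyIntegrable (coneKernel χ i j) := by
  have hd : Module.finrank ℝ (Eucl d) = n + 1 := Fact.out
  have hdn : d = n + 1 := by simpa using hd
  have : Nontrivial (Eucl d) := Module.nontrivial_of_finrank_pos (R := ℝ) (by omega)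
  obtain ⟨C, hC0, hC⟩ := exists_abs_raywiseExtension_le hχ.continuous
  have hmeas : AEStronglyMeasurable (coneKernel χ i j) volume := by
    -- The origin is a null set, so continuity away from it suffices.
    rw [← restrict_compl_singleton (μ := volume) (0 : Eucl d)]
    exact (contDiffOn_coneKernel hχ i j).continuousOn.aestronglyMeasurable
      (measurableSet_singleton _).compl
  have hball (r : ℝ) : IntegrableOn (coneKernel χ i j) (ball 0 r) := by
    have hint : IntegrableOn (fun x : Eucl d => C * ((‖x‖ ^ d)⁻¹ * ‖x‖ ^ 2)) (ball 0 r) := by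
      rw [integrableOn_fun_norm_addHaar volume (f := fun s => C * ((s ^ d)⁻¹ * s ^ 2)), hd]
      refine IntegrableOn.congr_fun (f := fun s => C * s) ?_ (fun s hs => ?_) measurableSet_Ioo
      · exact ((continuous_const.mul continuous_id).integrableOn_Icc (a := 0) (b := r)).mono_set
          Set.Ioo_subset_Icc_self
      · have hs0 : s ≠ 0 := hs.1.ne'
        simp only [hdn, Nat.add_sub_cancel, smul_eq_mul]
        field_simp
        ring
    refine Integrable.mono' hint hmeas.restrict (Filter.Eventually.of_forall fun x => ?_)
    rw [Real.norm_eq_abs, coneKernel, abs_mul, abs_mul, abs_mul,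
      abs_of_nonneg (a := (‖x‖ ^ d)⁻¹) (by positivity), mul_comm (‖x‖ ^ d)⁻¹, mul_assoc, pow_two]
    gcongr
    · exact hC x
    · exact PiLp.norm_apply_le x i
    · exact PiLp.norm_apply_le x j
  intro x
  exact ⟨ball 0 (‖x‖ + 1), isOpen_ball.mem_nhds (by simp), hball _⟩

/-! ### Distributions given by locally integrable functions. -/

/-- The distribution on `ℝ^d` given by integration against a locally integrable function `f`. -/
noncomputable def distrOfFun {d : ℕ} (f : Eucl d → ℝ) : Distr d :=
  (TestFunction.integralAgainstBilinCLM (ContinuousLinearMap.mul ℝ ℝ) volume f : Test d →L[ℝ] ℝ)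

theorem distrOfFun_apply {d : ℕ} {f : Eucl d → ℝ} (hf : LocallyIntegrable f) (φ : Test d) :
    distrOfFun f φ = ∫ x, f x * φ x := by
  have : distrOfFun f φ = ∫ x, φ x * f x :=
    TestFunction.integralAgainstBilinCLM_eq_integral (hf.locallyIntegrableOn _)
  rw [this]
  simp only [mul_comm]

theorem MeasureTheory.LocallyIntegrable.integrable_mul_test {d : ℕ} {f : Eucl d → ℝ}
    (hf : LocallyIntegrable f) (φ : Test d) : Integrable fun x => f x * φ x := by
  simpa [mul_comm] using
    φ.integrable_bilin (ContinuousLinearMap.mul ℝ ℝ) (hf.locallyIntegrableOn _)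

theorem isSmoothOn_distrOfFun {d : ℕ} {f : Eucl d → ℝ} {U : Set (Eucl d)}
    (hf : LocallyIntegrable f) (hfU : ContDiffOn ℝ ∞ f U) : IsSmoothOn (distrOfFun f) U :=
  ⟨f, hfU, fun φ _ => distrOfFun_apply hf φ⟩

theorem isVanishingOn_distrOfFun {d : ℕ} {f : Eucl d → ℝ} {C : Set (Eucl d)}
    (hf : LocallyIntegrable f) (hfC : ∀ x, f x ≠ 0 → x ∈ C) :
    Distribution.IsVanishingOn (distrOfFun f) Cᶜ := by
  intro φ hφ
  rw [distrOfFun_apply hf]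
  refine integral_eq_zero_of_ae (Filter.Eventually.of_forall fun x => ?_)
  by_contra h
  exact hφ (subset_tsupport φ (right_ne_zero_of_mul h)) (hfC x (left_ne_zero_of_mul h))

theorem isHomogeneousDistr_distrOfFun {d : ℕ} {f : Eucl d → ℝ} {a : ℝ}
    (hf : LocallyIntegrable f) (hfa : ∀ t : ℝ, 0 < t → ∀ x, f (t • x) = t ^ a * f x) :
    IsHomogeneousDistr (distrOfFun f) a := by
  intro t ht φ
  rw [distrOfFun_apply hf, distrOfFun_apply hf]
  have h (x : Eucl d) : f x * dilateTest t ht φ x = t ^ (-a) * (f (t • x) * φ (t • x)) := by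
    rw [hfa t ht, Real.rpow_neg ht.le]
    have := (Real.rpow_pos_of_pos ht a).ne'
    change f x * φ (t • x) = _
    field_simp
  simp only [h]
  rw [integral_const_mul, Measure.integral_comp_smul volume (fun x => f x * φ x) t, smul_eq_mul,
    ← mul_assoc, neg_add, Real.rpow_add ht, abs_of_pos (by positivity), finrank_euclideanSpace_fin,
    Real.rpow_neg ht.le (d : ℝ), Real.rpow_natCast]

/-! ### Polar coordinates and the double divergence of the kernel. -/

theorem MeasureTheory.Measure.integral_volumeIoiPow (n : ℕ) (g : ℝ → ℝ) :
    ∫ r : Set.Ioi (0 : ℝ), g r ∂(Measure.volumeIoiPow n) = ∫ r in Set.Ioi 0, r ^ n * g r := by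
  simp only [Measure.volumeIoiPow, ENNReal.ofReal]
  rw [integral_withDensity_eq_integral_smul (measurable_subtype_coe.pow_const _).real_toNNReal,
    integral_subtype_comap measurableSet_Ioi fun a : ℝ => Real.toNNReal (a ^ n) • g a]
  refine setIntegral_congr_fun measurableSet_Ioi fun r hr => ?_
  simp only [NNReal.smul_def, Real.coe_toNNReal _ (pow_nonneg (le_of_lt hr) n), smul_eq_mul]

/-- Integration in polar coordinates. -/
theorem MeasureTheory.integral_eq_integral_toSphere_integral_Ioi {E : Type*}
    [NormedAddCommGroup E] [NormedSpace ℝ E] [Nontrivial E] [FiniteDimensional ℝ E]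
    [MeasurableSpace E] [BorelSpace E] (μ : Measure E) [μ.IsAddHaarMeasure] {f : E → ℝ}
    (hf : Integrable f μ) :
    ∫ x, f x ∂μ = ∫ y : sphere (0 : E) 1,
      (∫ r in Set.Ioi (0 : ℝ), r ^ (Module.finrank ℝ E - 1) * f (r • (y : E))) ∂μ.toSphere := by
  have hmp := μ.measurePreserving_homeomorphUnitSphereProd
  have hemb := (homeomorphUnitSphereProd E).measurableEmbedding
  let g : sphere (0 : E) 1 × Set.Ioi (0 : ℝ) → ℝ := fun p => f ((p.2 : ℝ) • (p.1 : E))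
  have hg : g ∘ homeomorphUnitSphereProd E = fun x : ({0}ᶜ : Set E) => f x := by
    funext x
    simp only [g, Function.comp_apply, homeomorphUnitSphereProd_apply_fst_coe,
      homeomorphUnitSphereProd_apply_snd_coe]
    rw [smul_inv_smul₀ (norm_ne_zero_iff.2 x.2)]
  have hgint : Integrable g (μ.toSphere.prod (.volumeIoiPow (Module.finrank ℝ E - 1))) := by
    rw [← hmp.integrable_comp_emb hemb, hg]
    exact (integrableOn_iff_comap_subtypeVal (measurableSet_singleton _).compl).1
      hf.integrableOn
  calc
    ∫ x, f x ∂μ = ∫ x : ({0}ᶜ : Set E), f x ∂(μ.comap (↑)) := by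
      rw [integral_subtype_comap (measurableSet_singleton _).compl f, restrict_compl_singleton]
    _ = ∫ p, g p ∂μ.toSphere.prod (.volumeIoiPow (Module.finrank ℝ E - 1)) := by
      rw [← hmp.integral_comp hemb]
      exact integral_congr_ae (Filter.Eventually.of_forall fun x => (congrFun hg x).symm)
    _ = _ := by
      rw [integral_prod _ hgint]
      exact integral_congr_ae (Filter.Eventually.of_forall fun y =>
        Measure.integral_volumeIoiPow _ fun r => f (r • (y : E)))

/-- The integrand is the derivative of $rq'-q$, which vanishes for large $r$ and equals $-q(0)$ at
$r=0$. -/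
theorem integral_Ioi_mul_deriv_deriv {q : ℝ → ℝ} (hq : ContDiff ℝ 2 q)
    (hc : HasCompactSupport q) : ∫ r in Set.Ioi (0 : ℝ), r * deriv (deriv q) r = q 0 := by
  have hq' : ContDiff ℝ 1 (deriv q) := ((contDiff_succ_iff_deriv (n := 1)).1 hq).2.2
  have hF : ContDiff ℝ 1 fun r => r * deriv q r - q r :=
    (contDiff_id.mul hq').sub (hq.of_le one_le_two)
  have hFc : HasCompactSupport fun r => r * deriv q r - q r := hc.deriv.mul_left.sub hc
  have hderiv (r : ℝ) : deriv (fun r => r * deriv q r - q r) r = r * deriv (deriv q) r := by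
    have h1 := (hq'.differentiable one_ne_zero r).hasDerivAt
    have h2 := (hq.differentiable two_ne_zero r).hasDerivAt
    have h3 := (((hasDerivAt_id r).mul h1).sub h2).deriv
    simp only [id] at h3
    refine h3.trans ?_
    ring
  have h := hFc.integral_Ioi_deriv_eq hF 0
  simp only [hderiv] at h
  simpa using h

theorem TestFunction.integral_Ioi_mul_fderiv_fderiv {d : ℕ} (φ : Test d) {y : Eucl d}
    (hy : y ≠ 0) :
    ∫ r in Set.Ioi (0 : ℝ), r * fderiv ℝ (fderiv ℝ φ) (r • y) y y = φ 0 := by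
  have h1 (r : ℝ) : HasDerivAt (fun r : ℝ => r • y) y r := by
    simpa using (hasDerivAt_id r).smul_const y
  have hd1 : deriv (fun r : ℝ => φ (r • y)) = fun r => fderiv ℝ φ (r • y) y := by
    funext r
    exact ((φ.contDiff.differentiable (by simp) _).hasFDerivAt.comp_hasDerivAt r (h1 r)).deriv
  have hφ' : Differentiable ℝ (fderiv ℝ φ) :=
    (φ.contDiff.fderiv_right (m := 1) (by decide)).differentiable one_ne_zero
  have hd2 : deriv (deriv fun r : ℝ => φ (r • y)) =
      fun r => fderiv ℝ (fderiv ℝ φ) (r • y) y y := by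
    funext r
    rw [hd1]
    have := ((hφ' _).hasFDerivAt.comp_hasDerivAt r (h1 r)).clm_apply (hasDerivAt_const r y)
    simpa using this.deriv
  have hq : ContDiff ℝ 2 fun r : ℝ => φ (r • y) :=
    (φ.contDiff.of_le (by decide)).comp (contDiff_id.smul contDiff_const)
  -- Here `y ≠ 0` matters: the ray must leave the support of `φ`.
  have hqc : HasCompactSupport fun r : ℝ => φ (r • y) :=
    φ.hasCompactSupport.comp_isClosedEmbedding (isClosedEmbedding_smul_left hy)
  have := integral_Ioi_mul_deriv_deriv hq hqc
  rw [hd2] at this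
  simpa using this

theorem sum_coneKernel_mul_lineDerivOp {d : ℕ} (χ : sphere (0 : Eucl d) 1 → ℝ) (φ : Test d)
    (x : Eucl d) :
    ∑ i, ∑ j, coneKernel χ i j x *
      (∂_{(EuclideanSpace.single j (1 : ℝ) : Eucl d)}
        (∂_{(EuclideanSpace.single i (1 : ℝ) : Eucl d)} φ : Test d) : Test d) x =
    (‖x‖ ^ d)⁻¹ * raywiseExtension χ x * fderiv ℝ (fderiv ℝ φ) x x x := by
  have hx : x = ∑ i, x i • (EuclideanSpace.single i (1 : ℝ) : Eucl d) := by
    simpa using ((EuclideanSpace.basisFun (Fin d) ℝ).sum_repr x).symm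
  have hexp (B : Eucl d →L[ℝ] Eucl d →L[ℝ] ℝ) : B x x =
      ∑ i, ∑ j, x i * x j * B (EuclideanSpace.single j 1) (EuclideanSpace.single i 1) := by
    conv_lhs => rw [hx]
    simp only [map_sum, map_smul, sum_apply, smul_apply,
      smul_eq_mul, Finset.mul_sum, mul_assoc]
  rw [hexp, Finset.mul_sum]
  refine Finset.sum_congr rfl fun i _ => ?_
  rw [Finset.mul_sum]
  refine Finset.sum_congr rfl fun j _ => ?_
  rw [φ.lineDerivOp_lineDerivOp_apply, coneKernel]
  ring

theorem sum_partialD_partialD_coneKernel {d n : ℕ} [Fact (Module.finrank ℝ (Eucl d) = n + 1)]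
    {χ : sphere (0 : Eucl d) 1 → ℝ} (hχ : ContMDiff (𝓡 n) 𝓘(ℝ, ℝ) ∞ χ) :
    ∑ i, ∑ j, partialD i (partialD j (distrOfFun (coneKernel χ i j))) =
      (∫ v, χ v ∂(volume : Measure (Eucl d)).toSphere) • (Distribution.delta 0 : Distr d) := by
  have hd : Module.finrank ℝ (Eucl d) = n + 1 := Fact.out
  have hdn : d = n + 1 := by simpa using hd
  have : Nontrivial (Eucl d) := Module.nontrivial_of_finrank_pos (R := ℝ) (by omega)
  ext φ
  let D (i j : Fin d) : Test d := ∂_{(EuclideanSpace.single j (1 : ℝ) : Eucl d)}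
    (∂_{(EuclideanSpace.single i (1 : ℝ) : Eucl d)} φ : Test d)
  have hterm (i j : Fin d) : partialD i (partialD j (distrOfFun (coneKernel χ i j))) φ =
      ∫ x, coneKernel χ i j x * D i j x := by
    rw [← distrOfFun_apply (locallyIntegrable_coneKernel hχ i j)]
    simp only [partialD, Distribution.lineDerivOp_apply_apply, LineDeriv.lineDerivOp_neg,
      neg_neg, D]
  have hint (i j : Fin d) : Integrable fun x => coneKernel χ i j x * D i j x :=
    (locallyIntegrable_coneKernel hχ i j).integrable_mul_test _
  have hsum : (∑ i, ∑ j, partialD i (partialD j (distrOfFun (coneKernel χ i j)))) φ =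
      ∑ i, ∑ j, partialD i (partialD j (distrOfFun (coneKernel χ i j))) φ := by
    simp
  have hG : Integrable fun x : Eucl d => ∑ i, ∑ j, coneKernel χ i j x * D i j x :=
    integrable_finsetSum _ fun i _ => integrable_finsetSum _ fun j _ => hint i j
  have hswap : ∑ i, ∑ j, ∫ x, coneKernel χ i j x * D i j x =
      ∫ x, ∑ i, ∑ j, coneKernel χ i j x * D i j x := by
    rw [integral_finsetSum _ fun i _ => integrable_finsetSum _ fun j _ => hint i j]
    exact Finset.sum_congr rfl fun i _ => (integral_finsetSum _ fun j _ => hint i j).symm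
  simp only [hsum, hterm, hswap]
  rw [integral_eq_integral_toSphere_integral_Ioi volume hG]
  change _ = (∫ v, χ v ∂(volume : Measure (Eucl d)).toSphere) * φ 0
  rw [← integral_mul_const]
  refine integral_congr_ae (Filter.Eventually.of_forall fun y => ?_)
  simp only
  rw [← φ.integral_Ioi_mul_fderiv_fderiv (ne_zero_of_mem_unit_sphere y), ← integral_const_mul]
  refine setIntegral_congr_fun measurableSet_Ioi fun r (hr : 0 < r) => ?_
  simp only [D, sum_coneKernel_mul_lineDerivOp, raywiseExtension_smul χ hr, raywiseExtension_coe,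
    norm_smul, norm_eq_of_mem_sphere, Real.norm_of_nonneg hr.le, map_smul,
    smul_apply, smul_eq_mul, mul_one, hd, Nat.add_sub_cancel]
  -- The Jacobian $r^{d-1}$, the factor $r^{-d}$ of the kernel and the $r^2$ from
  -- $D^2\varphi(ry)(ry,ry)$ multiply to $r$.
  rw [show r ^ d = r ^ n * r by rw [hdn, pow_succ]]
  field_simp

/-! ### The symmetric divergence solution and the conclusion. -/

/-- The properties shared by all components of the matrices of fundamental solutions: vanishing
outside of `C`, homogeneity of degree `a`, and smoothness away from the origin. -/
structure IsHomogeneousSmoothIn {d : ℕ} (C : Set (Eucl d)) (a : ℝ) (T : Distr d) : Prop where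
  isVanishingOn : Distribution.IsVanishingOn T Cᶜ
  isHomogeneous : IsHomogeneousDistr T a
  isSmoothOn : IsSmoothOn T {0}ᶜ

namespace IsHomogeneousSmoothIn

variable {d : ℕ} {C : Set (Eucl d)} {a : ℝ} {S T : Distr d}

theorem zero : IsHomogeneousSmoothIn C a (0 : Distr d) :=
  ⟨fun _ _ => rfl, .zero, .zero⟩

theorem add (hS : IsHomogeneousSmoothIn C a S) (hT : IsHomogeneousSmoothIn C a T) :
    IsHomogeneousSmoothIn C a (S + T) :=
  ⟨hS.isVanishingOn.distr_add hT.isVanishingOn, hS.isHomogeneous.add hT.isHomogeneous,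
    hS.isSmoothOn.add isOpen_compl_singleton hT.isSmoothOn⟩

theorem smul (hT : IsHomogeneousSmoothIn C a T) (c : ℝ) : IsHomogeneousSmoothIn C a (c • T) :=
  ⟨hT.isVanishingOn.distr_smul c, hT.isHomogeneous.smul c, hT.isSmoothOn.smul c⟩

theorem sub (hS : IsHomogeneousSmoothIn C a S) (hT : IsHomogeneousSmoothIn C a T) :
    IsHomogeneousSmoothIn C a (S - T) := by
  have := hS.add (hT.smul (-1))
  rwa [neg_one_smul, ← sub_eq_add_neg] at this

theorem sum {ι : Type*} (s : Finset ι) {F : ι → Distr d}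
    (hF : ∀ i ∈ s, IsHomogeneousSmoothIn C a (F i)) :
    IsHomogeneousSmoothIn C a (∑ i ∈ s, F i) :=
  Finset.sum_induction _ _ (fun _ _ => add) zero hF

theorem lineDerivOp (hT : IsHomogeneousSmoothIn C a T) (v : Eucl d) :
    IsHomogeneousSmoothIn C (a - 1) (∂_{v} T : Distr d) :=
  ⟨hT.isVanishingOn.lineDerivOp v, hT.isHomogeneous.lineDerivOp v,
    hT.isSmoothOn.lineDerivOp isOpen_compl_singleton v⟩

end IsHomogeneousSmoothIn

theorem isHomogeneousSmoothIn_coneKernel {d n : ℕ} [Fact (Module.finrank ℝ (Eucl d) = n + 1)]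
    {χ : sphere (0 : Eucl d) 1 → ℝ} (hχ : ContMDiff (𝓡 n) 𝓘(ℝ, ℝ) ∞ χ) (i j : Fin d) :
    IsHomogeneousSmoothIn (coneOf χ) (2 - d) (distrOfFun (coneKernel χ i j)) := by
  have hloc := locallyIntegrable_coneKernel hχ i j
  refine ⟨isVanishingOn_distrOfFun hloc fun x hx => mem_coneOf_of_raywiseExtension_ne_zero
    (right_ne_zero_of_mul (left_ne_zero_of_mul hx)),
    isHomogeneousDistr_distrOfFun hloc fun t ht x => ?_,
    isSmoothOn_distrOfFun hloc (contDiffOn_coneKernel hχ i j)⟩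
  rw [coneKernel_smul χ i j ht, Real.rpow_sub ht, Real.rpow_natCast, Real.rpow_two]
  ring

/-- The symmetric matrix `w_j f_i + w_i f_j - ∂_w K_{ij}`, where `f_j = ∑ k, ∂_k K_{kj}` is the
divergence of `K`. -/
noncomputable def symmDivSolution {d : ℕ} (K : Fin d → Fin d → Distr d) (w : Eucl d)
    (i j : Fin d) : Distr d :=
  w j • ∑ k, partialD k (K k i) + w i • ∑ k, partialD k (K k j) - ∂_{w} (K i j)

theorem symmDivSolution_comm {d : ℕ} {K : Fin d → Fin d → Distr d}
    (hK : ∀ i j, K i j = K j i) (w : Eucl d) (i j : Fin d) :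
    symmDivSolution K w i j = symmDivSolution K w j i := by
  rw [symmDivSolution, symmDivSolution, hK i j, add_comm]

theorem lineDerivOp_eq_sum_partialD {d : ℕ} (T : Distr d) (w : Eucl d) :
    (∂_{w} T : Distr d) = ∑ i, w i • partialD i T := by
  have hw : w = ∑ i, w i • (EuclideanSpace.single i (1 : ℝ) : Eucl d) := by
    simpa using ((EuclideanSpace.basisFun (Fin d) ℝ).sum_repr w).symm
  conv_lhs => rw [hw]
  simp only [LineDeriv.lineDerivOp_left_sum, LineDeriv.lineDerivOp_left_smul, partialD]

theorem partialD_sum {d : ℕ} {ι : Type*} (i : Fin d) (s : Finset ι) (F : ι → Distr d) :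
    partialD i (∑ k ∈ s, F k) = ∑ k ∈ s, partialD i (F k) :=
  LineDeriv.lineDerivOp_sum _ _ _

/-- The first term contributes $w^j$ times the double divergence. The other two contribute
$\partial_wf_j$ and $-\partial_wf_j$, since derivatives commute. -/
theorem sum_partialD_symmDivSolution {d : ℕ} {K : Fin d → Fin d → Distr d}
    (hK : ∀ i j, K i j = K j i) {T : Distr d}
    (hdiv : ∑ i, ∑ j, partialD i (partialD j (K i j)) = T) (w : Eucl d) (j : Fin d) :
    ∑ i, partialD i (symmDivSolution K w i j) = w j • T := by
  have hterm (i : Fin d) : partialD i (symmDivSolution K w i j) =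
      w j • ∑ k, partialD i (partialD k (K i k)) + w i • partialD i (∑ k, partialD k (K k j)) -
        ∂_{w} (partialD i (K i j)) := by
    simp only [symmDivSolution, hK _ i, ← partialD_sum]
    simp only [partialD, sub_eq_add_neg, ← neg_one_smul ℝ (∂_{w} _ : Distr d),
      LineDeriv.lineDerivOp_add, LineDeriv.lineDerivOp_smul]
    rw [Distribution.lineDerivOp_comm (K i j), hK i j]
  simp only [hterm, Finset.sum_sub_distrib, Finset.sum_add_distrib, ← Finset.smul_sum, hdiv]
  rw [← lineDerivOp_eq_sum_partialD, LineDeriv.lineDerivOp_sum, add_sub_cancel_right]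

theorem IsHomogeneousSmoothIn.symmDivSolution {d : ℕ} {C : Set (Eucl d)} {a : ℝ}
    {K : Fin d → Fin d → Distr d} (hK : ∀ i j, IsHomogeneousSmoothIn C a (K i j))
    (w : Eucl d) (i j : Fin d) :
    IsHomogeneousSmoothIn C (a - 1) (symmDivSolution K w i j) :=
  (((sum _ fun k _ => (hK k i).lineDerivOp _).smul _).add
    ((sum _ fun k _ => (hK k j).lineDerivOp _).smul _)).sub ((hK i j).lineDerivOp w)

theorem theorem4 (d n : ℕ) (hd : 3 ≤ d) [Fact (Module.finrank ℝ (Eucl d) = n + 1)]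
    (χ : sphere (0 : Eucl d) 1 → ℝ)
    (hχ : ContMDiff (𝓡 n) 𝓘(ℝ, ℝ) ∞ χ)
    (hint : ∫ v, χ v ∂(volume : Measure (Eucl d)).toSphere = 1)
    (hcone : Convex ℝ (coneOf χ)) :
    (∃ K : Fin d → Fin d → Distr d,
      (∑ i, ∑ j, partialD i (partialD j (K i j)) = Distribution.delta 0) ∧
      (∀ i j, K i j = K j i) ∧
      (∀ i j, Distribution.dsupport (K i j) ⊆ coneOf χ) ∧
      (∀ i j, IsHomogeneousDistr (K i j) (2 - (d : ℝ))) ∧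
      (∀ i j, IsSmoothOn (K i j) {0}ᶜ)) ∧
    (∀ w : sphere (0 : Eucl d) 1, ∃ L : Fin d → Fin d → Distr d,
      (∀ j, ∑ i, partialD i (L i j) = (w : Eucl d) j • Distribution.delta 0) ∧
      (∀ i j, L i j = L j i) ∧
      (∀ i j, Distribution.dsupport (L i j) ⊆ coneOf χ) ∧
      (∀ i j, IsHomogeneousDistr (L i j) (1 - (d : ℝ))) ∧
      (∀ i j, IsSmoothOn (L i j) {0}ᶜ)) := by
  let K (i j : Fin d) : Distr d := distrOfFun (coneKernel χ i j)
  have hdiv : ∑ i, ∑ j, partialD i (partialD j (K i j)) = Distribution.delta 0 := by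
    rw [sum_partialD_partialD_coneKernel hχ, hint, one_smul]
  have hsymm (i j : Fin d) : K i j = K j i := congrArg distrOfFun (coneKernel_comm χ i j)
  have hK (i j : Fin d) : IsHomogeneousSmoothIn (coneOf χ) (2 - d) (K i j) :=
    isHomogeneousSmoothIn_coneKernel hχ i j
  have hL (w : Eucl d) (i j : Fin d) :
      IsHomogeneousSmoothIn (coneOf χ) (1 - d) (symmDivSolution K w i j) := by
    convert! IsHomogeneousSmoothIn.symmDivSolution hK w i j using 1
    ring
  have hsupp {a : ℝ} {T : Distr d} (hT : IsHomogeneousSmoothIn (coneOf χ) a T) :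
      Distribution.dsupport T ⊆ coneOf χ :=
    Distribution.dsupport_subset_of_isVanishingOn_compl isClosed_closure hT.isVanishingOn
  exact ⟨⟨K, hdiv, hsymm, fun i j => hsupp (hK i j), fun i j => (hK i j).isHomogeneous,
    fun i j => (hK i j).isSmoothOn⟩, fun w => ⟨symmDivSolution K w,
    sum_partialD_symmDivSolution hsymm hdiv w, symmDivSolution_comm hsymm w,
    fun i j => hsupp (hL w i j), fun i j => (hL w i j).isHomogeneous,
    fun i j => (hL w i j).isSmoothOn⟩⟩
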